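/- An algebra $\mathcal M=(M,\mathcal F)$ consists of a set $M$ and a set $\mathcal F$ of finitary functions on $M$ (functions $M^n\to M$, $n$ finite) which contains the identity function and is closed under composition, i.e. under forming $f(g_1(\vec x_1),\dots,g_n(\vec x_n))$ from an $n$-ary $f\in\mathcal F$ and $g_1,\dots,g_n\in\mathcal F$ of arbitrary arities. A subalgebra is a subset $N\subseteq M$ closed under all functions in $\mathcal F$; let $\mathrm{Sub}(\mathcal M)$ be the set of all subalgebras. For $A\subseteq M$ put $\mathrm{Cl}_{\mathcal M}(A)=\{F(\vec a): F\in\mathcal F,\ \vec a\in A\}$; $A$ is free if $a\notin \mathrm{Cl}_{\mathcal M}(A\setminus\{a\})$ for every $a\in A$. For a cardinal $\kappa$, $\Pr(\kappa)$ says that every algebra $\mathcal M=(M,\mathcal F)$ with $|M|=\kappa$ and $|\mathcal F|<\kappa$ has a free subset $A\subseteq M$ with $|A|=\kappa$. A cardinal is weakly inaccessible if it is an uncountable regular limit cardinal, and inaccessible if it is an uncountable regular strong limit cardinal. The principle $(*)$ is the conjunction of: (S1) for every infinite cardinal $\kappa$, $2^\kappa$ is weakly inaccessible, and $2^\lambda=2^\kappa$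 for every cardinal $\lambda$ with $\kappa\le\lambda<2^\kappa$; (S2) for every infinite cardinal $\kappa$, $\Pr(2^\kappa)$ holds. **Corollary.** Assume that $(*)$ holds and that there are no inaccessible cardinals. Then every algebra $\mathcal M=(M,\mathcal F)$ with $|M|>\aleph_1$ and $\mathcal F$ countable satisfies $|\mathrm{Sub}(\mathcal M)|=2^{|M|}$. -/

import Mathlib

open Cardinal

universe u

/-- A finitary function on `M`: an arity `n` together with a function `M ^ n → M`. -/
abbrev FinitaryFunction (M : Type u) : Type u := Σ n : ℕ, ((Fin n → M) → M)

namespace FinitaryFunction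

/-- The identity function on `M`, as a function of one variable. -/
def identity (M : Type u) : FinitaryFunction M := ⟨1, fun x => x 0⟩

/-- The composition `f (g₁ (x⃗₁), …, gₙ (x⃗ₙ))` of an `n`-ary function `f` with functions
`g₁, …, gₙ` of arbitrary arities; its argument is the concatenation of `x⃗₁, …, x⃗ₙ`. -/
def comp {M : Type u} (f : FinitaryFunction M) (g : Fin f.1 → FinitaryFunction M) :
    FinitaryFunction M :=
  ⟨∑ i, (g i).1, fun x => f.2 fun i => (g i).2 fun j => x (finSigmaFinEquiv ⟨i, j⟩)⟩

end FinitaryFunction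

/-- An algebra on `M`: a set of finitary functions on `M` which is closed under composition and
contains the identity function. -/
structure AlgebraOn (M : Type u) where
  functions : Set (FinitaryFunction M)
  identity_mem : FinitaryFunction.identity M ∈ functions
  comp_mem : ∀ (f : FinitaryFunction M) (g : Fin f.1 → FinitaryFunction M),
    f ∈ functions → (∀ i, g i ∈ functions) → FinitaryFunction.comp f g ∈ functions

namespace AlgebraOn

variable {M : Type u} (𝓜 : AlgebraOn M)

/-- `N` is a subalgebra: it is closed under all the functions of the algebra. -/
def IsSubalgebra (N : Set M) : Prop :=
  ∀ f ∈ 𝓜.functions, ∀ x : Fin f.1 → M, (∀ i, x i ∈ N) → f.2 x ∈ N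

/-- The set of all subalgebras. -/
def Sub : Set (Set M) := {N | 𝓜.IsSubalgebra N}

/-- The closure of `A`: all values of functions of the algebra at tuples from `A`. -/
def Cl (A : Set M) : Set M :=
  {b | ∃ f ∈ 𝓜.functions, ∃ x : Fin f.1 → M, (∀ i, x i ∈ A) ∧ f.2 x = b}

/-- `A` is free: no element of `A` is in the closure of the other elements of `A`. -/
def IsFree (A : Set M) : Prop := ∀ a ∈ A, a ∉ 𝓜.Cl (A \ {a})

end AlgebraOn

/-- `Pr κ`: every algebra of cardinality `κ` with fewer than `κ` functions has a free subset of
cardinality `κ`. -/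
def Pr (κ : Cardinal.{u}) : Prop :=
  ∀ (M : Type u) (𝓜 : AlgebraOn M), #M = κ → #𝓜.functions < κ →
    ∃ A : Set M, 𝓜.IsFree A ∧ #A = κ

/-- Weakly inaccessible cardinals: uncountable regular limit cardinals. -/
def IsWeaklyInaccessible (κ : Cardinal.{u}) : Prop :=
  ℵ₀ < κ ∧ κ.IsRegular ∧ Order.IsSuccLimit κ

/-- First part of the principle `(*)`. -/
def PrincipleS1 : Prop :=
  ∀ κ : Cardinal.{u}, ℵ₀ ≤ κ →
    IsWeaklyInaccessible ((2 : Cardinal.{u}) ^ κ) ∧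
      ∀ l : Cardinal.{u}, κ ≤ l → l < 2 ^ κ → (2 : Cardinal.{u}) ^ l = 2 ^ κ

/-- Second part of the principle `(*)`. -/
def PrincipleS2 : Prop :=
  ∀ κ : Cardinal.{u}, ℵ₀ ≤ κ → Pr ((2 : Cardinal.{u}) ^ κ)

/-- The principle `(*)`, for the sets and cardinals of the universe `u`. -/
def PrincipleStar : Prop := PrincipleS1.{u} ∧ PrincipleS2.{u}

/-! Let `k = #M` and let `l` be least with `k < 2 ^ l`. By (S1) `2 ^ l = 2 ^ k`, so `2 ^ l`
subalgebras suffice, and minimality leaves three cases (`PrincipleS1.exists_two_power_eq`). If `l =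
2 ^ ν`, then (S2) yields a free set of size `l` inside a subalgebra of size `l`, and its subsets
generate distinct subalgebras (`two_power_le_mk_Sub_of_Pr`). If `l` is an uncountable strong limit,
it is singular, since nothing is inaccessible. Each of the `l ^ cof l = 2 ^ l` sequences of length
`cof l` generates a small subalgebra, and each such subalgebra arises from fewer than `2 ^ l`
sequences (`two_power_le_mk_Sub_of_isSingular`). If `l = ℵ₀`, continuum many subalgebras come from a
binary tree of generating sets, kept growing by a game on `ω₂` (`two_power_aleph0_le_mk_Sub`). -/

namespace AlgebraOn

variable {M : Type u} (𝓜 : AlgebraOn M)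

/-! ### Closures and their cardinalities -/

theorem Cl_mono {A B : Set M} (h : A ⊆ B) : 𝓜.Cl A ⊆ 𝓜.Cl B := by
  rintro b ⟨f, hf, x, hx, rfl⟩
  exact ⟨f, hf, x, fun i => h (hx i), rfl⟩

theorem subset_Cl (A : Set M) : A ⊆ 𝓜.Cl A := fun a ha =>
  ⟨_, 𝓜.identity_mem, fun _ => a, fun _ => ha, rfl⟩

theorem Cl_isSubalgebra (A : Set M) : 𝓜.IsSubalgebra (𝓜.Cl A) := by
  intro f hf x hx
  choose g hg y hy hyx using hx
  refine ⟨_, 𝓜.comp_mem f g hf hg,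
    fun k => y (finSigmaFinEquiv.symm k).1 (finSigmaFinEquiv.symm k).2, fun k => hy _ _, ?_⟩
  exact congrArg f.2 (funext fun i => (congrArg (g i).2 (funext fun k =>
    congrArg (fun p : Σ i, Fin (g i).1 => y p.1 p.2)
      (finSigmaFinEquiv.symm_apply_apply ⟨i, k⟩))).trans (hyx i))

/-- The closure operator is finitary. -/
theorem exists_mem_Cl_of_mem_Cl_iUnion {A : ℕ → Set M} (hA : Monotone A) {b : M}
    (hb : b ∈ 𝓜.Cl (⋃ n, A n)) : ∃ n, b ∈ 𝓜.Cl (A n) := by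
  obtain ⟨f, hf, x, hx, rfl⟩ := hb
  choose n hn using fun i => Set.mem_iUnion.1 (hx i)
  exact ⟨Finset.univ.sup n, f, hf, x,
    fun i => hA (Finset.le_sup (Finset.mem_univ i)) (hn i), rfl⟩

theorem Cl_eq_iUnion (A : Set M) :
    𝓜.Cl A = ⋃ f : 𝓜.functions, Set.range fun x : Fin f.1.1 → A => f.1.2 fun i => (x i : M) := by
  ext b
  simp only [Cl, Set.mem_ofPred_eq, Set.mem_iUnion, Set.mem_range, Subtype.exists]
  constructor
  · rintro ⟨f, hf, x, hx, rfl⟩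
    exact ⟨f, hf, fun i => ⟨x i, hx i⟩, rfl⟩
  · rintro ⟨f, hf, x, rfl⟩
    exact ⟨f, hf, fun i => x i, fun i => (x i).2, rfl⟩

theorem mk_Cl_le (hF : 𝓜.functions.Countable) (A : Set M) : #(𝓜.Cl A) ≤ max ℵ₀ #A := by
  rw [Cl_eq_iUnion]
  have hF' : #𝓜.functions ≤ ℵ₀ := Cardinal.le_aleph0_iff_set_countable.2 hF
  refine (mk_iUnion_le _).trans ?_
  refine (mul_le_mul' (hF'.trans (le_max_left _ #A)) (ciSup_le' (a := max ℵ₀ #A) fun f => ?_)).trans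
    (mul_eq_self (le_max_left _ _)).le
  refine mk_range_le.trans ?_
  rw [mk_arrow, mk_fin, lift_id', lift_natCast, Cardinal.power_natCast]
  exact (pow_le_pow_left' (le_max_right ℵ₀ #A) _).trans
    (power_nat_le (le_max_left _ _))

theorem countable_Cl (hF : 𝓜.functions.Countable) {A : Set M} (hA : A.Countable) :
    (𝓜.Cl A).Countable := by
  rw [← Cardinal.le_aleph0_iff_set_countable] at hA ⊢
  exact (𝓜.mk_Cl_le hF A).trans (by simp [hA])

theorem mk_Sub_le : #𝓜.Sub ≤ 2 ^ #M := by
  rw [← mk_set]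
  exact mk_set_le _

theorem exists_isSubalgebra_mk_eq (hF : 𝓜.functions.Countable) {l : Cardinal.{u}} (hl : ℵ₀ ≤ l)
    (hlM : l ≤ #M) : ∃ N : Set M, 𝓜.IsSubalgebra N ∧ #N = l := by
  obtain ⟨S, rfl⟩ := le_mk_iff_exists_set.1 hlM
  exact ⟨𝓜.Cl S, 𝓜.Cl_isSubalgebra S,
    ((𝓜.mk_Cl_le hF S).trans (max_eq_right hl).le).antisymm (mk_le_mk_of_subset (𝓜.subset_Cl S))⟩

/-! ### Restriction to subalgebras, and free sets -/

/-- The algebra induced on a subset `N`: its functions are the restrictions to `N` of those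
functions of the algebra that preserve `N`. -/
def restrict (N : Set M) : AlgebraOn N where
  functions := {g | ∃ f : (Fin g.1 → M) → M, (⟨g.1, f⟩ : FinitaryFunction M) ∈ 𝓜.functions ∧
    ∀ x : Fin g.1 → N, (g.2 x : M) = f fun i => x i}
  identity_mem := ⟨(FinitaryFunction.identity M).2, 𝓜.identity_mem, fun _ => rfl⟩
  comp_mem := by
    rintro ⟨n, f⟩ g ⟨f', hf', hff'⟩ hg
    choose g' hg' hgg' using hg
    refine ⟨_, 𝓜.comp_mem ⟨n, f'⟩ (fun i => ⟨(g i).1, g' i⟩) hf' hg', fun x => ?_⟩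
    simp only [FinitaryFunction.comp]
    rw [hff']
    congr 1
    funext i
    rw [hgg']

theorem restrict_functions_countable (hF : 𝓜.functions.Countable) (N : Set M) :
    (𝓜.restrict N).functions.Countable := by
  have : Countable 𝓜.functions := hF
  have hres : ∀ g : (𝓜.restrict N).functions, ∃ f : (Fin g.1.1 → M) → M,
      (⟨g.1.1, f⟩ : FinitaryFunction M) ∈ 𝓜.functions ∧
        ∀ x : Fin g.1.1 → N, (g.1.2 x : M) = f fun i => x i := fun g => g.2
  choose F hF hgF using hres
  refine Set.countable_coe_iff.1 (Function.Injective.countable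
    (f := fun g : (𝓜.restrict N).functions => (⟨_, hF g⟩ : 𝓜.functions)) ?_)
  rintro ⟨⟨n, g⟩, hg⟩ ⟨⟨m, h⟩, hh⟩ H
  have H1 := congrArg Subtype.val H
  obtain rfl : n = m := congrArg Sigma.fst H1
  have H2 := eq_of_heq (Sigma.mk.inj H1).2
  have : g = h := by
    funext x
    apply Subtype.ext
    have h1 := hgF ⟨⟨n, g⟩, hg⟩ x
    have h2 := hgF ⟨⟨n, h⟩, hh⟩ x
    exact h1.trans ((congrFun H2 _).trans h2.symm)
  subst this
  rfl

theorem image_val_mem_Sub {N : Set M} (hN : 𝓜.IsSubalgebra N) {K : Set N}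
    (hK : K ∈ (𝓜.restrict N).Sub) : Subtype.val '' K ∈ 𝓜.Sub := by
  rintro ⟨n, f⟩ hf x hx
  choose y hy hyx using hx
  have hfx : ∀ z : Fin n → N, f (fun i => z i) ∈ N := fun z => hN _ hf _ fun i => (z i).2
  have hmem : (⟨n, fun z => ⟨_, hfx z⟩⟩ : FinitaryFunction N) ∈ (𝓜.restrict N).functions :=
    Exists.intro f ⟨hf, fun _ => rfl⟩
  have := hK _ hmem y hy
  refine ⟨_, this, ?_⟩
  change f (fun i => y i) = f x
  congr 1
  funext i
  exact hyx i

theorem mk_Sub_restrict_le {N : Set M} (hN : 𝓜.IsSubalgebra N) :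
    #(𝓜.restrict N).Sub ≤ #𝓜.Sub :=
  mk_le_of_injective (f := fun K => ⟨_, 𝓜.image_val_mem_Sub hN K.2⟩) fun _ _ h =>
    Subtype.ext (Subtype.val_injective.image_injective (congrArg Subtype.val h))

/-- Distinct subsets of a free set have distinct closures: if `a ∈ B \ C`, then `a` lies in the
closure of `B`, whereas the closure of `C` is contained in that of `A \ {a}`. -/
theorem two_power_le_mk_Sub_of_isFree {A : Set M} (hA : 𝓜.IsFree A) : 2 ^ #A ≤ #𝓜.Sub := by
  rw [← mk_set]
  have key : ∀ B C : Set A, 𝓜.Cl (Subtype.val '' B) = 𝓜.Cl (Subtype.val '' C) → B ⊆ C := by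
    intro B C h a ha
    by_contra hC
    refine hA a a.2 (𝓜.Cl_mono ?_ (h ▸ 𝓜.subset_Cl _ (Set.mem_image_of_mem _ ha)))
    rintro _ ⟨c, hc, rfl⟩
    refine ⟨c.2, fun hca => hC ?_⟩
    rwa [← Subtype.ext (Set.mem_singleton_iff.1 hca)]
  exact mk_le_of_injective
    (f := fun B : Set A => (⟨_, 𝓜.Cl_isSubalgebra (Subtype.val '' B)⟩ : 𝓜.Sub))
    fun B C h => (key B C (congrArg Subtype.val h)).antisymm
      (key C B (congrArg Subtype.val h).symm)

theorem two_power_le_mk_Sub_of_Pr (hF : 𝓜.functions.Countable) {l : Cardinal.{u}} (hl : ℵ₀ < l)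
    (hlM : l ≤ #M) (hPr : Pr l) : 2 ^ l ≤ #𝓜.Sub := by
  obtain ⟨N, hN, hNl⟩ := 𝓜.exists_isSubalgebra_mk_eq hF hl.le hlM
  obtain ⟨A, hA, rfl⟩ := hPr N (𝓜.restrict N) hNl
    ((Cardinal.le_aleph0_iff_set_countable.2 (𝓜.restrict_functions_countable hF N)).trans_lt hl)
  exact ((𝓜.restrict N).two_power_le_mk_Sub_of_isFree hA).trans (𝓜.mk_Sub_restrict_le hN)

/-! ### Counting sequences: singular strong limits -/

/-- There are at most `μ ^ μ` sequences of length `μ` in a set generated by `μ` elements. -/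
theorem power_le_mk_Sub_mul (hF : 𝓜.functions.Countable) {l μ : Cardinal.{u}} (hμ : ℵ₀ ≤ μ)
    (hlM : l ≤ #M) : l ^ μ ≤ #𝓜.Sub * 2 ^ μ := by
  obtain ⟨S, rfl⟩ := le_mk_iff_exists_set.1 hlM
  induction μ using Cardinal.inductionOn with | _ ι => ?_
  rw [power_def]
  let Φ : (ι → S) → 𝓜.Sub := fun x => ⟨_, 𝓜.Cl_isSubalgebra (Set.range fun i => (x i : M))⟩
  refine mk_le_mk_mul_of_mk_preimage_le Φ fun N => ?_
  rcases (Φ ⁻¹' {N}).eq_empty_or_nonempty with h | ⟨x₀, hx₀⟩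
  · simp [h]
  have hN : #N.1 ≤ #ι := by
    rw [← show Φ x₀ = N from hx₀]
    exact (𝓜.mk_Cl_le hF _).trans (max_le hμ mk_range_le)
  calc #(Φ ⁻¹' {N}) ≤ #(ι → N.1) := by
        refine mk_le_of_injective (f := fun x i => ⟨(x.1 i : M), ?_⟩) ?_
        · have hx : (Φ x.1).1 = N.1 := congrArg Subtype.val x.2
          exact hx ▸ 𝓜.subset_Cl _ ⟨i, rfl⟩
        · intro x y h
          ext i
          have hi := congrArg Subtype.val (congrFun h i)
          exact hi
    _ ≤ #ι ^ #ι := by rw [← power_def]; exact power_le_power_right hN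
    _ = 2 ^ #ι := power_self_eq hμ

end AlgebraOn

/-- A subset of `l` is determined by its traces on `cof l` many initial segments covering `l`; each
segment has fewer than `l` elements, hence fewer than `l` subsets. -/
theorem Cardinal.IsStrongPrelimit.two_power_le_power_cof {l : Cardinal.{u}}
    (hl : IsStrongPrelimit l) (hl₀ : ℵ₀ ≤ l) : 2 ^ l ≤ l ^ l.ord.cof := by
  obtain ⟨s, hs, hsl⟩ := Order.exists_cof_eq l.ord.ToType
  rw [Ordinal.cof_toType] at hsl
  have h : l ≤ Cardinal.sum fun i : s => #(Set.Iic i.1) := by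
    calc l = #(⋃ i : s, Set.Iic i.1) := by
          rw [show (⋃ i : s, Set.Iic i.1) = Set.univ from ?_]
          · simp
          · refine Set.eq_univ_of_forall fun x => ?_
            obtain ⟨y, hy, hxy⟩ := hs x
            exact Set.mem_iUnion.2 ⟨⟨y, hy⟩, hxy⟩
      _ ≤ _ := mk_iUnion_le_sum_mk
  have hlt : ∀ i : s, #(Set.Iic i.1) < l := fun i => by
    rw [← Set.Iio_insert]
    refine mk_insert_le.trans_lt (add_lt_of_lt hl₀ ?_ (one_lt_aleph0.trans_le hl₀))
    simpa using mk_Iio_lt i.1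
  calc (2 : Cardinal.{u}) ^ l ≤ 2 ^ Cardinal.sum fun i : s => #(Set.Iic i.1) :=
        power_le_power_left two_ne_zero h
    _ = Cardinal.prod fun i : s => 2 ^ #(Set.Iic i.1) := power_sum _ _
    _ ≤ Cardinal.prod fun _ : s => l := prod_le_prod _ _ fun i => (hl (hlt i)).le
    _ = l ^ l.ord.cof := by rw [prod_const', hsl]

namespace AlgebraOn

variable {M : Type u} (𝓜 : AlgebraOn M)

theorem two_power_le_mk_Sub_of_isSingular (hF : 𝓜.functions.Countable) {l : Cardinal.{u}}
    (hl : l.IsSingular) (hl' : l.IsStrongPrelimit) (hlM : l ≤ #M) : 2 ^ l ≤ #𝓜.Sub := by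
  have hμ : ℵ₀ ≤ l.ord.cof := (isRegular_cof (isSuccLimit_ord hl.aleph0_le)).aleph0_le
  by_contra! h
  have h2 : (2 : Cardinal.{u}) ^ l.ord.cof < 2 ^ l := (hl' hl.cof_ord_lt).trans (cantor l)
  -- A product of two cardinals below the infinite cardinal `2 ^ l` stays below it.
  exact ((hl'.two_power_le_power_cof hl.aleph0_le).trans (𝓜.power_le_mk_Sub_mul hF hμ hlM)).not_gt
    (mul_lt_of_lt (hl.aleph0_le.trans (cantor l).le) h h2)

end AlgebraOn

/-! ### A game of length ω -/

section Game

variable {M I : Type u} [LinearOrder I]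

/-- The first player wins the game of length `ω` in which, in each round, he names a lower bound
and his opponent answers by an element above it; the opponent loses as soon as the set `A`,
together with the images of the chosen elements, is not `ok`. -/
def FirstPlayerWins (j : I → M) (ok : Set M → Prop) (A : Set M) : Prop :=
  ∃ σ : List I → I, ∀ x : ℕ → I, (∀ n, σ (List.ofFn fun i : Fin n => x i) < x n) →
    ∃ n, ¬ ok (A ∪ (fun i => j (x i)) '' Set.Iio n)

theorem FirstPlayerWins.of_not_ok [Nonempty I] (j : I → M) {ok : Set M → Prop} {A : Set M}
    (h : ¬ ok A) : FirstPlayerWins j ok A :=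
  ⟨fun _ => Classical.arbitrary I, fun _ _ => ⟨0, by simpa using h⟩⟩

theorem FirstPlayerWins.of_move {j : I → M} {ok : Set M → Prop} {A : Set M} {ξ : I}
    (h : ∀ α, ξ < α → FirstPlayerWins j ok (insert (j α) A)) : FirstPlayerWins j ok A := by
  classical
  choose! σ hσ using h
  -- The strategy opens with `ξ`, then follows the one attached to the first answer, with that
  -- answer removed from the history.
  refine ⟨fun l => l.casesOn ξ σ, fun x hx => ?_⟩
  have h0 : ξ < x 0 := hx 0
  obtain ⟨n, hn⟩ := hσ (x 0) h0 (fun n => x (n + 1)) fun n => by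
    have := hx (n + 1)
    rwa [List.ofFn_succ] at this
  refine ⟨n + 1, ?_⟩
  convert hn using 2
  ext y
  simp only [Set.mem_union, Set.mem_image, Set.mem_Iio, Set.mem_insert_iff]
  constructor
  · rintro (h | ⟨_ | i, hi, rfl⟩)
    · exact Or.inl (Or.inr h)
    · exact Or.inl (Or.inl rfl)
    · exact Or.inr ⟨i, by omega, rfl⟩
  · rintro ((rfl | h) | ⟨i, hi, rfl⟩)
    · exact Or.inr ⟨0, by omega, rfl⟩
    · exact Or.inl h
    · exact Or.inr ⟨i + 1, by omega, rfl⟩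

/-- If the first player wins each game of a family such that families of lower bounds have a common
upper bound, then some play is a defeat of his opponent in all these games. -/
theorem FirstPlayerWins.exists_common_play {Ω : Type*} {j : I → M} {ok : Ω → Set M → Prop}
    {A : Set M} (hI : ∀ f : Ω → I, ∃ x, ∀ d, f d < x) (h : ∀ d, FirstPlayerWins j (ok d) A) :
    ∃ x : ℕ → I, ∀ d, ∃ n, ¬ ok d (A ∪ (fun i => j (x i)) '' Set.Iio n) := by
  choose σ hσ using h
  choose g hg using fun l => hI fun d => σ d l
  -- `L n` is the history of the first `n` answers; each answer `g` exceeds the bounds named by all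
  -- the strategies at once.
  let L : ℕ → List I := fun n => Nat.rec [] (fun _ l => l ++ [g l]) n
  have hL : ∀ n, List.ofFn (fun i : Fin n => g (L i)) = L n := by
    intro n
    induction n with
    | zero => rfl
    | succ n ih =>
      rw [List.ofFn_succ_last]
      change List.ofFn (fun i : Fin n => g (L i)) ++ [g (L n)] = L n ++ [g (L n)]
      rw [ih]
  refine ⟨fun n => g (L n), fun d => hσ d _ fun n => ?_⟩
  rw [hL]
  exact hg _ d

end Game

/-! ### A splitting tree and continuum many subalgebras -/

/-- A binary tree of sets along which a family of codes splits. -/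
theorem exists_cantor_scheme {M : Type u} {P : Set M → Prop} {A : Set M} (hA : P A)
    {R : Set M → Set M → Prop}
    (hsplit : ∀ A, P A → ∃ A₀ A₁, A ⊆ A₀ ∧ A ⊆ A₁ ∧ P A₀ ∧ P A₁ ∧ R A₀ A₁) :
    ∃ T : (ℕ → Bool) → ℕ → Set M, (∀ b, Monotone (T b)) ∧ (∀ b n, P (T b n)) ∧
      ∀ b c, b ≠ c → ∃ n, R (T b n) (T c n) ∨ R (T c n) (T b n) := by
  choose! S₀ S₁ h₀ h₁ hP₀ hP₁ hR using hsplit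
  let T : (ℕ → Bool) → ℕ → Set M := fun b n =>
    Nat.rec A (fun n B => if b n then S₁ B else S₀ B) n
  have hT : ∀ b n, T b (n + 1) = if b n then S₁ (T b n) else S₀ (T b n) := fun _ _ => rfl
  have hP : ∀ b n, P (T b n) := by
    intro b n
    induction n with
    | zero => exact hA
    | succ n ih => rw [hT]; split_ifs; exacts [hP₁ _ ih, hP₀ _ ih]
  refine ⟨T, fun b => monotone_nat_of_le_succ fun n => ?_, hP, fun b c hbc => ?_⟩
  · rw [hT]; split_ifs; exacts [h₁ _ (hP b n), h₀ _ (hP b n)]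
  · have hex : ∃ n, b n ≠ c n := Function.ne_iff.1 hbc
    classical
    have hagree : ∀ n ≤ Nat.find hex, T b n = T c n := by
      intro n
      induction n with
      | zero => exact fun _ => rfl
      | succ n ih =>
        intro hn
        rw [hT, hT, ih (by omega), not_not.1 (Nat.find_min hex (m := n) (by omega))]
    -- The two branches share their node at the first difference, and the split made there appears
    -- one level later.
    refine ⟨Nat.find hex + 1, ?_⟩
    have hne := Nat.find_spec hex
    rw [hT, hT, ← hagree _ le_rfl]
    have := hR _ (hP b (Nat.find hex))
    cases hb : b (Nat.find hex) <;> cases hc : c (Nat.find hex) <;> simp_all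

namespace AlgebraOn

variable {M : Type u} (𝓜 : AlgebraOn M)

/-- **Baumgartner–Taylor**: an algebra of cardinality at least `ℵ₂` with countably many functions
has at least `2 ^ ℵ₀` subalgebras. -/
theorem two_power_aleph0_le_mk_Sub (hF : 𝓜.functions.Countable) (hM : ℵ₁ < #M) :
    2 ^ ℵ₀ ≤ #𝓜.Sub := by
  let Ω : Type u := (ℵ₁ : Cardinal.{u}).ord.ToType
  let I : Type u := (Order.succ (ℵ₁ : Cardinal.{u})).ord.ToType
  have hΩ : #Ω = ℵ₁ := mk_ord_toType _
  have hIcard : #I = Order.succ ℵ₁ := mk_ord_toType _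
  have hreg : (Order.succ (ℵ₁ : Cardinal.{u})).IsRegular := isRegular_succ aleph0_lt_aleph_one.le
  have hIcof : Order.cof I = Order.succ ℵ₁ := by rw [Ordinal.cof_toType, hreg.cof_ord]
  have hΩcof : Order.cof Ω = ℵ₁ := by rw [Ordinal.cof_toType, isRegular_aleph_one.cof_ord]
  have hI : ∀ f : Ω → I, ∃ x, ∀ d, f d < x := fun f => by
    have h := mt (Order.cof_le (s := Set.range f))
      (not_le.2 (mk_range_le.trans_lt (by rw [hIcof, hΩ]; exact Order.lt_succ _)))
    obtain ⟨x, hx⟩ := not_isCofinal_iff.1 h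
    exact ⟨x, fun d => hx _ ⟨d, rfl⟩⟩
  have hΩb : ∀ s : Set Ω, s.Countable → ∃ d, ∀ x ∈ s, x < d := fun s hs => by
    have h := mt (Order.cof_le (s := s))
      (not_le.2 ((Cardinal.le_aleph0_iff_set_countable.2 hs).trans_lt
        (by rw [hΩcof]; exact aleph0_lt_aleph_one)))
    exact not_isCofinal_iff.1 h
  have : Nonempty I := by rw [← mk_ne_zero_iff, hIcard]; exact hreg.ne_zero
  obtain ⟨⟨j, hj⟩⟩ : #I ≤ #M := hIcard.trans_le (Order.succ_le_of_lt hM)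
  -- Each `α < ω₂` has at most `ℵ₁` predecessors, so `e α` can code them injectively by elements of
  -- `ω₁`.
  have he : ∀ α : I, ∃ e : I → Ω, Set.InjOn e (Set.Iio α) := fun α => by
    have : #(Set.Iio α) ≤ #Ω := by
      rw [hΩ, ← Order.lt_succ_iff]
      exact (mk_Iio_lt α (by simp [I])).trans_eq hIcard
    obtain ⟨e⟩ := this
    have : Nonempty Ω := by rw [← mk_ne_zero_iff, hΩ]; exact isRegular_aleph_one.ne_zero
    classical
    refine ⟨fun β => if h : β < α then e ⟨β, h⟩ else Classical.arbitrary Ω, fun x hx y hy h => ?_⟩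
    simp only [Set.mem_Iio] at hx hy
    simp only [hx, hy, dif_pos] at h
    exact congrArg Subtype.val (e.injective h)
  choose e he using he
  -- All codes arising inside the closure of `A` stay below `δ`. Once `j β` lies in an `ok δ`
  -- closure, only countably many `j α` with `α < β` can.
  let ok : Ω → Set M → Prop := fun δ A =>
    ∀ α β, j α ∈ 𝓜.Cl A → j β ∈ 𝓜.Cl A → β < α → e α β < δ
  have hok_mono : ∀ δ {A B}, A ⊆ B → ok δ B → ok δ A := fun δ A B hAB h α β hα hβ =>
    h α β (𝓜.Cl_mono hAB hα) (𝓜.Cl_mono hAB hβ)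
  have hok_iUnion : ∀ δ (A : ℕ → Set M), Monotone A → (∀ n, ok δ (A n)) → ok δ (⋃ n, A n) := by
    intro δ A hA h α β hα hβ
    obtain ⟨m, hm⟩ := 𝓜.exists_mem_Cl_of_mem_Cl_iUnion hA hα
    obtain ⟨n, hn⟩ := 𝓜.exists_mem_Cl_of_mem_Cl_iUnion hA hβ
    exact h (max m n) α β (𝓜.Cl_mono (hA (le_max_left _ _)) hm)
      (𝓜.Cl_mono (hA (le_max_right _ _)) hn)
  -- Otherwise one play loses for every `δ < ω₁`. But the closure of its countably many elements is
  -- countable, so some `δ` bounds all the codes arising there.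
  obtain ⟨δ, hδ⟩ : ∃ δ, ¬ FirstPlayerWins j (ok δ) ∅ := by
    by_contra! h
    obtain ⟨x, hx⟩ := FirstPlayerWins.exists_common_play hI h
    have hC : {α | j α ∈ 𝓜.Cl (Set.range fun i => j (x i))}.Countable :=
      (𝓜.countable_Cl hF (Set.countable_range _)).preimage hj
    obtain ⟨δ, hδ⟩ := hΩb _ ((hC.prod hC).image fun p => e p.1 p.2)
    obtain ⟨n, hn⟩ := hx δ
    refine hn (hok_mono δ (B := Set.range fun i => j (x i)) ?_ ?_)
    · rw [Set.empty_union]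
      exact Set.image_subset_range _ _
    · exact fun α β hα hβ _ => hδ _ ⟨(α, β), ⟨hα, hβ⟩, rfl⟩
  have hP_ok : ∀ A, ¬ FirstPlayerWins j (ok δ) A → ok δ A := fun A hA => by
    by_contra h
    exact hA (.of_not_ok j h)
  have hP_move : ∀ A, ¬ FirstPlayerWins j (ok δ) A → ∀ ξ, ∃ α, ξ < α ∧
      ¬ FirstPlayerWins j (ok δ) (insert (j α) A) := fun A hA ξ => by
    by_contra! h
    exact hA (.of_move h)
  obtain ⟨T, hTmono, hTP, hTR⟩ := exists_cantor_scheme (P := fun A => ¬ FirstPlayerWins j (ok δ) A)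
    (R := fun A₀ A₁ => ∃ a ∈ A₁, ∀ B, A₀ ⊆ B → ok δ B → a ∉ 𝓜.Cl B) hδ (by
    intro A hA
    -- The non-losing moves are cofinal in `ω₂`, so there are more than `ℵ₁` of them.
    have hS : #Ω < #{α | ¬ FirstPlayerWins j (ok δ) (insert (j α) A)} := by
      rw [hΩ, ← Order.succ_le_iff]
      refine hIcof.ge.trans (Order.cof_le fun ξ => ?_)
      obtain ⟨α, hα, h⟩ := hP_move A hA ξ
      exact ⟨α, h, hα.le⟩
    obtain ⟨f⟩ := hS.le
    obtain ⟨ξ, hξ⟩ := hI fun d => f d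
    have : Nonempty Ω := by rw [← mk_ne_zero_iff, hΩ]; exact isRegular_aleph_one.ne_zero
    let d₀ : Ω := Classical.arbitrary Ω
    obtain ⟨β, hβ, hPβ⟩ := hP_move _ (f d₀).2 ξ
    -- The `ℵ₁` chosen moves lie below `β` and have distinct codes under `e β`, while only countably
    -- many codes are below `δ`. A move with code at least `δ` can never join `j β` in an `ok δ`
    -- closure.
    obtain ⟨d, hd⟩ : ∃ d, δ ≤ e β (f d) := by
      by_contra! h
      have hle : #Ω ≤ #(Set.Iio δ) :=
        mk_le_of_injective (f := fun d => ⟨e β (f d), h d⟩) fun d d' hdd' =>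
          f.injective (Subtype.ext (he β ((hξ d).trans hβ) ((hξ d').trans hβ)
            (congrArg Subtype.val hdd')))
      exact hle.not_gt (mk_Iio_lt δ (by simp [Ω]))
    refine ⟨_, _, (Set.subset_insert _ _).trans (Set.subset_insert _ _), Set.subset_insert _ _,
      hPβ, (f d).2, j (f d), Set.mem_insert _ _, fun B hB hokB hmem => ?_⟩
    exact (hokB β (f d) (𝓜.subset_Cl B (hB (Set.mem_insert _ _))) hmem
      ((hξ d).trans hβ)).not_ge hd)
  have hTok : ∀ b, ok δ (⋃ n, T b n) := fun b =>
    hok_iUnion δ _ (hTmono b) fun n => hP_ok _ (hTP b n)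
  have key : ∀ b c n, (∃ a ∈ T c n, ∀ B, T b n ⊆ B → ok δ B → a ∉ 𝓜.Cl B) →
      𝓜.Cl (⋃ n, T b n) ≠ 𝓜.Cl (⋃ n, T c n) := by
    rintro b c n ⟨a, ha, h⟩ heq
    refine h _ (Set.subset_iUnion _ n) (hTok b) ?_
    rw [heq]
    exact 𝓜.subset_Cl _ (Set.mem_iUnion.2 ⟨n, ha⟩)
  have hcantor : lift.{u} #(ℕ → Bool) ≤ lift.{0} #𝓜.Sub :=
    lift_mk_le_lift_mk_of_injective (f := fun b : ℕ → Bool =>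
      (⟨_, 𝓜.Cl_isSubalgebra (⋃ n, T b n)⟩ : 𝓜.Sub)) fun b c hbc => by
    by_contra hne
    obtain ⟨n, hn | hn⟩ := hTR b c hne
    · exact key b c n hn (congrArg Subtype.val hbc)
    · exact key c b n hn (congrArg Subtype.val hbc).symm
  simpa using hcantor

end AlgebraOn

/-! ### Cardinal arithmetic under (S1) and the conclusion -/

/-- A cardinal `l` that is least with `k < 2 ^ l` determines `2 ^ k` under `(S1)`, and it is a
power of two, or `ℵ₀`, or an uncountable strong limit. -/
theorem PrincipleS1.exists_two_power_eq (h : PrincipleS1.{u}) {k : Cardinal.{u}} (hk : ℵ₀ ≤ k) :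
    ∃ l ≤ k, (2 : Cardinal.{u}) ^ l = 2 ^ k ∧
      (l = ℵ₀ ∨ (∃ ν, ℵ₀ ≤ ν ∧ l = 2 ^ ν) ∨ (ℵ₀ < l ∧ l.IsStrongPrelimit)) := by
  obtain ⟨l, hkl, hmin⟩ := WellFounded.has_min (α := Cardinal.{u}) wellFounded_lt
    {l | k < 2 ^ l} ⟨k, cantor k⟩
  have hkl : k < 2 ^ l := hkl
  have hmin : ∀ ν < l, 2 ^ ν ≤ k := fun ν hν => not_lt.1 fun h' => hmin ν h' hν
  have hlk : l ≤ k := not_lt.1 fun h' => (hmin k h').not_gt (cantor k)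
  have hl : ℵ₀ ≤ l := by
    by_contra! hl
    exact (hk.trans_lt hkl).not_gt (power_lt_aleph0 (natCast_lt_aleph0 (n := 2)) hl)
  refine ⟨l, hlk, ((h l hl).2 k hlk hkl).symm, ?_⟩
  rcases hl.eq_or_lt with hl' | hl'
  · exact Or.inl hl'.symm
  -- If `l < 2 ^ ν`, then (S1) gives `2 ^ l = 2 ^ ν`, which is at most `k` by minimality of `l`, a
  -- contradiction.
  have hpow : ∀ ν < l, ℵ₀ ≤ ν → 2 ^ ν ≤ l := fun ν hν hν₀ => by
    by_contra! hlt
    exact (hmin ν hν).not_gt ((h ν hν₀).2 l hν.le hlt ▸ hkl)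
  by_cases hex : ∃ ν, ℵ₀ ≤ ν ∧ l = 2 ^ ν
  · exact Or.inr (Or.inl hex)
  refine Or.inr (Or.inr ⟨hl', fun ν hν => ?_⟩)
  rcases lt_or_ge ν ℵ₀ with hν₀ | hν₀
  · exact (power_lt_aleph0 (natCast_lt_aleph0 (n := 2)) hν₀).trans hl'
  · exact (hpow ν hν hν₀).lt_of_ne fun heq => hex ⟨ν, hν₀, heq.symm⟩

theorem mainTheorem4 (hstar : PrincipleStar.{u})
    (hinacc : ¬ ∃ κ : Cardinal.{u}, κ.IsInaccessible)
    (M : Type u) (𝓜 : AlgebraOn M) (hM : ℵ₁ < #M) (hF : 𝓜.functions.Countable) :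
    #𝓜.Sub = (2 : Cardinal.{u}) ^ #M := by
  refine 𝓜.mk_Sub_le.antisymm ?_
  obtain ⟨l, hlM, hl, rfl | ⟨ν, hν, rfl⟩ | ⟨hl₀, hlim⟩⟩ :=
    hstar.1.exists_two_power_eq (aleph0_lt_aleph_one.le.trans hM.le)
  · exact hl ▸ 𝓜.two_power_aleph0_le_mk_Sub hF hM
  · exact hl ▸ 𝓜.two_power_le_mk_Sub_of_Pr hF (hν.trans_lt (cantor ν)) hlM (hstar.2 ν hν)
  · rcases isRegular_or_isSingular hl₀.le with hreg | hsing
    · exact (hinacc ⟨l, hl₀, hreg.le_cof_ord, hlim⟩).elim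
    · exact hl ▸ 𝓜.two_power_le_mk_Sub_of_isSingular hF hsing hlim hlM
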